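/- Let $G$ be a finite group and $H\le G$ a subgroup. **Definitions.** A $G$-ring is a commutative ring with an action of $G$ by ring automorphisms. An ideal $I$ of a $G$-ring $R$ is *$G$-prime* if $g(I)\subseteq I$ for all $g\in G$, $I\ne R$, and whenever $x\notin I$ and $y\notin I$ there is $g\in G$ with $x\cdot gy\notin I$; the $G$-ring $R$ is *domain-like* if its zero ideal is $G$-prime. For an $H$-ring $R$, $\mathrm{CoInd}_H^G R$ is the $G$-ring of functions $\varphi\colon G\to R$ with $\varphi(hx)=h\varphi(x)$ for all $h\in H$, $x\in G$, with pointwise operations and $(g\varphi)(x)=\varphi(xg)$. A *$G$-Tambara functor* $R$ assigns to each finite $G$-set $X$ a commutative ring $R(X)$ and to each equivariant map $f\colon X\to Y$ a ring homomorphism (restriction) $R(Y)\to R(X)$, an additive homomorphism (transfer) $R(X)\to R(Y)$ and a multiplicative homomorphism (norm) $R(X)\to R(Y)$, all functorial, such that $R$ takes finite disjoint unions to products, transfers and norms commute with restrictions along pullback squares, and norms distribute over transfers along exponential diagrams. A *Tambara ideal* $I$ of $R$ is a family of ideals $I(G/K)\subseteq R(G/K)$, $K\le G$, closed under restrictions,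 transfers and norms along all equivariant maps $G/K\to G/L$ (equivalently: under the restrictions, transfers and norms along the projections $G/K\to G/L$, $K\le L$, and under conjugations). The product $I\cdot J$ of two Tambara ideals is the smallest Tambara ideal that contains $I(G/K)\cdot J(G/K)$ for all $K\le G$. A Tambara ideal $\mathfrak p$ is *prime* if it is not all of $R$ and $I\cdot J\subseteq\mathfrak p$ implies $I\subseteq\mathfrak p$ or $J\subseteq\mathfrak p$ for all Tambara ideals $I,J$; $R$ is *domain-like* if its zero ideal is prime. For an $H$-Tambara functor $R$, $\mathrm{CoInd}_H^G R$ is the $G$-Tambara functor $X\mapsto R(\mathrm{Res}_H^G X)$, where $\mathrm{Res}_H^G X$ is the underlying $H$-set of $X$. **Proposition.** 1. For every $H$-ring $R$, the $G$-ring $\mathrm{CoInd}_H^G R$ is domain-like if and only if the $H$-ring $R$ is domain-like. 2. For every $H$-Tambara functor $R$, the $G$-Tambara functor $\mathrm{CoInd}_H^G R$ is domain-like if and only if the $H$-Tambara functor $R$ is domain-like. -/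

import Mathlib

universe u v w

/-! ### Equivariant rings -/

/-- For a group `G` and a commutative ring `R` with an action of `G` by ring automorphisms (a
`G`-ring), an ideal `I` is `G`-prime if it is `G`-invariant, proper, and whenever `x ∉ I` and
`y ∉ I` there is some `g : G` with `x * (g • y) ∉ I`. -/
structure IsGPrime (G : Type u) [Group G] {R : Type v} [CommRing R] [MulSemiringAction G R]
    (I : Ideal R) : Prop where
  smul_mem : ∀ (g : G) (x : R), x ∈ I → g • x ∈ I
  ne_top : I ≠ ⊤
  exists_mul_smul_notMem : ∀ x y : R, x ∉ I → y ∉ I → ∃ g : G, x * (g • y) ∉ I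

/-- A `G`-ring is domain-like if its zero ideal is `G`-prime. -/
def IsDomainLikeRing (G : Type u) [Group G] (R : Type v) [CommRing R]
    [MulSemiringAction G R] : Prop :=
  IsGPrime G (⊥ : Ideal R)

/-- The coinduction of an `H`-ring `R` to `G`: the ring of left `H`-equivariant maps `G → R` under
pointwise operations. -/
def coindRing {G : Type u} [Group G] (H : Subgroup G) (R : Type v) [CommRing R]
    [MulSemiringAction H R] : Subring (G → R) where
  carrier := {φ | ∀ (h : H) (x : G), φ ((h : G) * x) = h • φ x}
  mul_mem' {a b} ha hb h x := by
    rw [Pi.mul_apply, Pi.mul_apply, ha h x, hb h x, smul_mul']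
  one_mem' h x := by simp
  add_mem' {a b} ha hb h x := by
    rw [Pi.add_apply, Pi.add_apply, ha h x, hb h x, smul_add]
  zero_mem' h x := by simp
  neg_mem' {a} ha h x := by
    rw [Pi.neg_apply, Pi.neg_apply, ha h x, smul_neg]

/-- `G` acts on the coinduction by right translation: `(g • φ) x = φ (x * g)`. -/
instance coindRing.instMulSemiringAction {G : Type u} [Group G] (H : Subgroup G) (R : Type v)
    [CommRing R] [MulSemiringAction H R] : MulSemiringAction G (coindRing H R) where
  smul g φ := ⟨fun x => φ.1 (x * g), fun h x => by
    have := φ.2 h (x * g)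
    rwa [← mul_assoc] at this⟩
  one_smul φ := Subtype.ext (funext fun x => congrArg φ.1 (mul_one x))
  mul_smul g k φ := Subtype.ext (funext fun x => congrArg φ.1 (mul_assoc x g k).symm)
  smul_zero _ := rfl
  smul_add _ _ _ := rfl
  smul_one _ := rfl
  smul_mul _ _ _ := rfl

/-! ### Finite `G`-sets -/

/-- A finite `G`-set. Maps of finite `G`-sets are the equivariant maps `X →[G] Y`. -/
structure FinGSet (G : Type u) [Group G] where
  carrier : Type u
  [action : MulAction G carrier]
  [finite : Finite carrier]

namespace FinGSet

instance (G : Type u) [Group G] : CoeSort (FinGSet G) (Type u) := ⟨FinGSet.carrier⟩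

attribute [instance] FinGSet.action FinGSet.finite

/-- The transitive `G`-set `G ⧸ K`. -/
def orbit {G : Type u} [Group G] [Finite G] (K : Subgroup G) : FinGSet G where
  carrier := G ⧸ K

/-- The empty `G`-set. -/
def empty (G : Type u) [Group G] : FinGSet G where
  carrier := PEmpty.{u + 1}
  action :=
    { smul := fun _ x => x
      one_smul := fun _ => rfl
      mul_smul := fun _ _ _ => rfl }

/-- The underlying `H`-set of a finite `G`-set. -/
def restrict {G : Type u} [Group G] (H : Subgroup G) (X : FinGSet G) : FinGSet H where
  carrier := X

/-- A map of `G`-sets, viewed as a map of `H`-sets. -/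
def restrictHom {G : Type u} [Group G] (H : Subgroup G) {X Y : FinGSet G} (f : X →[G] Y) :
    X.restrict H →[H] Y.restrict H where
  toFun x := f x
  map_smul' h x := f.map_smul (h : G) x

end FinGSet

/-- The square of maps of sets with `a : W → X`, `b : W → Y`, `f : X → Z`, `g : Y → Z` is a pullback
square: it commutes and `W` maps bijectively to the fibre product of `X` and `Y` over `Z`. -/
def IsPullbackSquare {W X Y Z : Type u} (a : W → X) (b : W → Y) (f : X → Z) (g : Y → Z) : Prop :=
  (∀ t, f (a t) = g (b t)) ∧ ∀ x y, f x = g y → ∃! t, a t = x ∧ b t = y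

/-- The diagram
```
  X <--p-- A <--e-- B
  |                 |
  f                 f'
  v                 v
  Y <------q------- P
```
is an exponential diagram, i.e. it is isomorphic to the diagram in which `P` is the dependent
product of `p` along `f` (the set of pairs `(y, s)` of a point `y` of `Y` and a section `s` of `p`
over `f ⁻¹ {y}`), `q (y, s) = y`, `B` is the fibre product of `X` and `P` over `Y`, and
`e (x, (y, s)) = s x`. For diagrams of `G`-sets and equivariant maps the bijection between `P` and
this set of pairs is automatically equivariant for the action `(g • s) x = g • s (g⁻¹ • x)`. -/
structure IsExponentialDiagram {A B P X Y : Type u} (p : A → X) (f : X → Y) (e : B → A)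
    (f' : B → P) (q : P → Y) : Prop where
  pullback : IsPullbackSquare (fun b => p (e b)) f' f q
  existsUnique_of_section : ∀ (y : Y) (s : {x : X // f x = y} → A), (∀ x, p (s x) = x) →
    ∃! z : P, q z = y ∧ ∀ (b : B) (x : {x : X // f x = y}), f' b = z → p (e b) = x → e b = s x

/-! ### Tambara functors -/

/-- A `G`-Tambara functor, defined on all finite `G`-sets: each map `f : X → Y` of finite `G`-sets
has a restriction `res f : R Y → R X`, a transfer `tr f : R X → R Y` and a norm
`nm f : R X → R Y`. -/
structure TambaraFunctor (G : Type u) [Group G] where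
  obj : FinGSet G → Type w
  [commRing : ∀ X, CommRing (obj X)]
  res : ∀ {X Y : FinGSet G}, (X →[G] Y) → (obj Y →+* obj X)
  tr : ∀ {X Y : FinGSet G}, (X →[G] Y) → (obj X →+ obj Y)
  nm : ∀ {X Y : FinGSet G}, (X →[G] Y) → (obj X →* obj Y)
  res_id : ∀ (X : FinGSet G) (a : obj X), res (MulActionHom.id G (X := X)) a = a
  tr_id : ∀ (X : FinGSet G) (a : obj X), tr (MulActionHom.id G (X := X)) a = a
  nm_id : ∀ (X : FinGSet G) (a : obj X), nm (MulActionHom.id G (X := X)) a = a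
  res_comp : ∀ {X Y Z : FinGSet G} (g : Y →[G] Z) (f : X →[G] Y) (a : obj Z),
    res (g.comp f) a = res f (res g a)
  tr_comp : ∀ {X Y Z : FinGSet G} (g : Y →[G] Z) (f : X →[G] Y) (a : obj X),
    tr (g.comp f) a = tr g (tr f a)
  nm_comp : ∀ {X Y Z : FinGSet G} (g : Y →[G] Z) (f : X →[G] Y) (a : obj X),
    nm (g.comp f) a = nm g (nm f a)
  /-- The empty `G`-set is sent to the zero ring. -/
  subsingleton_of_isEmpty : ∀ X : FinGSet G, IsEmpty X → Subsingleton (obj X)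
  /-- Disjoint unions are sent to products. -/
  bijective_of_coproduct : ∀ {X Y Z : FinGSet G} (i : X →[G] Z) (j : Y →[G] Z),
    Function.Bijective (Sum.elim i j) →
      Function.Bijective (fun c : obj Z => (res i c, res j c))
  res_tr : ∀ {W X Y Z : FinGSet G} (a : W →[G] X) (b : W →[G] Y) (f : X →[G] Z) (g : Y →[G] Z),
    IsPullbackSquare a b f g → ∀ c : obj X, res g (tr f c) = tr b (res a c)
  res_nm : ∀ {W X Y Z : FinGSet G} (a : W →[G] X) (b : W →[G] Y) (f : X →[G] Z) (g : Y →[G] Z),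
    IsPullbackSquare a b f g → ∀ c : obj X, res g (nm f c) = nm b (res a c)
  /-- The distributive law: the norm of a transfer along an exponential diagram. -/
  nm_tr : ∀ {A B P X Y : FinGSet G} (p : A →[G] X) (f : X →[G] Y) (e : B →[G] A)
    (f' : B →[G] P) (q : P →[G] Y), IsExponentialDiagram p f e f' q →
      ∀ c : obj A, nm f (tr p c) = tr q (nm f' (res e c))

namespace TambaraFunctor

attribute [instance] TambaraFunctor.commRing

/-- The coinduction of an `H`-Tambara functor to `G`, given by `(CoInd R) X = R (Res X)`; this is
the right adjoint of the restriction functor from `G`-Tambara functors to `H`-Tambara functors. -/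
def coind {G : Type u} [Group G] (H : Subgroup G) (R : TambaraFunctor.{u, w} H) :
    TambaraFunctor.{u, w} G where
  obj X := R.obj (X.restrict H)
  res f := R.res (FinGSet.restrictHom H f)
  tr f := R.tr (FinGSet.restrictHom H f)
  nm f := R.nm (FinGSet.restrictHom H f)
  res_id X := R.res_id (X.restrict H)
  tr_id X := R.tr_id (X.restrict H)
  nm_id X := R.nm_id (X.restrict H)
  res_comp g f := R.res_comp (FinGSet.restrictHom H g) (FinGSet.restrictHom H f)
  tr_comp g f := R.tr_comp (FinGSet.restrictHom H g) (FinGSet.restrictHom H f)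
  nm_comp g f := R.nm_comp (FinGSet.restrictHom H g) (FinGSet.restrictHom H f)
  subsingleton_of_isEmpty X hX := R.subsingleton_of_isEmpty (X.restrict H) hX
  bijective_of_coproduct i j hij :=
    R.bijective_of_coproduct (FinGSet.restrictHom H i) (FinGSet.restrictHom H j) hij
  res_tr a b f g h := R.res_tr (FinGSet.restrictHom H a) (FinGSet.restrictHom H b)
    (FinGSet.restrictHom H f) (FinGSet.restrictHom H g) h
  res_nm a b f g h := R.res_nm (FinGSet.restrictHom H a) (FinGSet.restrictHom H b)
    (FinGSet.restrictHom H f) (FinGSet.restrictHom H g) h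
  nm_tr p f e f' q h := R.nm_tr (FinGSet.restrictHom H p) (FinGSet.restrictHom H f)
    (FinGSet.restrictHom H e) (FinGSet.restrictHom H f') (FinGSet.restrictHom H q) h

/-- Norms along maps with nonempty fibres send zero to zero. -/
theorem nm_zero {G : Type u} [Group G] (R : TambaraFunctor.{u, w} G) {X Y : FinGSet G}
    (f : X →[G] Y) (hf : Function.Surjective f) : R.nm f 0 = 0 := by
  let E : FinGSet G := FinGSet.empty G
  let p : E →[G] X := ⟨fun x => x.elim, fun _ x => x.elim⟩
  let q : E →[G] Y := ⟨fun x => x.elim, fun _ x => x.elim⟩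
  have hE : IsEmpty E := inferInstanceAs (IsEmpty PEmpty)
  have hs : Subsingleton (R.obj E) := R.subsingleton_of_isEmpty E hE
  have key := R.nm_tr p f (MulActionHom.id G) (MulActionHom.id G) q
    ⟨⟨fun t => hE.elim t, fun _ t => hE.elim t⟩, fun y s => by
      obtain ⟨x, hx⟩ := hf y
      exact hE.elim (s ⟨x, hx⟩)⟩ 0
  rw [map_zero] at key
  rw [key, Subsingleton.elim (R.nm (MulActionHom.id G) _) (0 : R.obj E), map_zero]

end TambaraFunctor

/-! ### Ideals of Tambara functors -/

/-- A Tambara ideal of `R`: ideals of the rings `R (G ⧸ K)`, for the subgroups `K` of `G`, closed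
under transfers, norms and restrictions along all maps `G ⧸ K → G ⧸ L` of transitive `G`-sets.
(Every such map is the composite of a conjugation isomorphism `x K ↦ x g (g⁻¹ K g)` and a
projection `G ⧸ K' → G ⧸ L` with `K' ≤ L`.) -/
@[ext]
structure TambaraIdeal {G : Type u} [Group G] [Finite G] (R : TambaraFunctor.{u, w} G) where
  carrier : ∀ K : Subgroup G, Ideal (R.obj (FinGSet.orbit K))
  tr_mem : ∀ {K L : Subgroup G} (f : FinGSet.orbit K →[G] FinGSet.orbit L),
    ∀ a ∈ carrier K, R.tr f a ∈ carrier L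
  nm_mem : ∀ {K L : Subgroup G} (f : FinGSet.orbit K →[G] FinGSet.orbit L),
    ∀ a ∈ carrier K, R.nm f a ∈ carrier L
  res_mem : ∀ {K L : Subgroup G} (f : FinGSet.orbit K →[G] FinGSet.orbit L),
    ∀ a ∈ carrier L, R.res f a ∈ carrier K

theorem FinGSet.surjective_orbitHom {G : Type u} [Group G] [Finite G] {K L : Subgroup G}
    (f : FinGSet.orbit K →[G] FinGSet.orbit L) : Function.Surjective f := by
  intro y
  let x : FinGSet.orbit K := (QuotientGroup.mk 1 : G ⧸ K)
  obtain ⟨g, hg⟩ := MulAction.exists_smul_eq G (show G ⧸ L from f x) (show G ⧸ L from y)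
  exact ⟨g • x, (f.map_smul g x).trans hg⟩

namespace TambaraIdeal

variable {G : Type u} [Group G] [Finite G] {R : TambaraFunctor.{u, w} G}

/-- Containment of Tambara ideals. -/
instance : LE (TambaraIdeal R) := ⟨fun I J => ∀ K, I.carrier K ≤ J.carrier K⟩

/-- The zero Tambara ideal. -/
instance : Bot (TambaraIdeal R) where
  bot :=
    { carrier := fun _ => ⊥
      tr_mem := fun f a ha => by
        rw [Ideal.mem_bot] at ha ⊢
        rw [ha, map_zero]
      nm_mem := fun f a ha => by
        rw [Ideal.mem_bot] at ha ⊢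
        rw [ha, R.nm_zero f (FinGSet.surjective_orbitHom f)]
      res_mem := fun f a ha => by
        rw [Ideal.mem_bot] at ha ⊢
        rw [ha, map_zero] }

/-- The Tambara ideal that is everything. -/
instance : Top (TambaraIdeal R) where
  top :=
    { carrier := fun _ => ⊤
      tr_mem := fun _ _ _ => Submodule.mem_top
      nm_mem := fun _ _ _ => Submodule.mem_top
      res_mem := fun _ _ _ => Submodule.mem_top }

/-- The Tambara ideal generated by a family of sets `S K ⊆ R (G ⧸ K)`: the intersection of all
Tambara ideals that contain it. -/
def span (S : ∀ K : Subgroup G, Set (R.obj (FinGSet.orbit K))) : TambaraIdeal R where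
  carrier K := ⨅ Q : {Q : TambaraIdeal R // ∀ L, S L ⊆ Q.carrier L}, Q.1.carrier K
  tr_mem f a ha := by
    rw [Ideal.mem_iInf] at ha ⊢
    exact fun Q => Q.1.tr_mem f a (ha Q)
  nm_mem f a ha := by
    rw [Ideal.mem_iInf] at ha ⊢
    exact fun Q => Q.1.nm_mem f a (ha Q)
  res_mem f a ha := by
    rw [Ideal.mem_iInf] at ha ⊢
    exact fun Q => Q.1.res_mem f a (ha Q)

/-- The product of two Tambara ideals: the Tambara ideal generated by the products of elements of
the same level. -/
instance : Mul (TambaraIdeal R) where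
  mul I J := span fun K => {c | ∃ a ∈ I.carrier K, ∃ b ∈ J.carrier K, c = a * b}

/-- A Tambara ideal `P` is prime if it is proper and `I * J ≤ P` implies `I ≤ P` or `J ≤ P`, for all
Tambara ideals `I` and `J`. -/
structure IsPrime (P : TambaraIdeal R) : Prop where
  ne_top : P ≠ ⊤
  le_or_le : ∀ I J : TambaraIdeal R, I * J ≤ P → I ≤ P ∨ J ≤ P

end TambaraIdeal

/-- A Tambara functor is domain-like if its zero ideal is prime. -/
def TambaraFunctor.IsDomainLike {G : Type u} [Group G] [Finite G]
    (R : TambaraFunctor.{u, w} G) : Prop :=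
  (⊥ : TambaraIdeal R).IsPrime

/-! ### Coinduced rings -/

/-! For rings, `CoInd R` is a product of copies of `R` indexed by `H\G` and permuted transitively by
`G`. Elements supported on the coset `H` (`coindRing.single`) have product zero after a translation
by `g ∉ H`, so on them the condition for `G` reduces to the one for `H`. Conversely, translation
brings nonzero values at any two points to the same point, up to the action of any chosen element of
`H`.

For Tambara functors, vanishing of a product of ideals is a levelwise condition (`mul_le_bot_iff`),
and ideals can be moved both ways. An ideal of `R` extends to all finite `H`-sets by testing on
orbits; evaluating at `Res (G ⧸ K)` gives an ideal of the coinduction. In the other direction, `H ⧸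
L` is the orbit of the base point in `Res (G ⧸ L)`, so `R (H ⧸ L)` is a direct factor of `(CoInd R)
(G ⧸ L)`, and an ideal of the coinduction projects to it. Both passages preserve zero products, and
an ideal with zero image is zero. Primality of the zero ideal therefore transfers both ways. -/

section CoindRing

variable {G : Type u} [Group G] (H : Subgroup G) (R : Type v) [CommRing R] [MulSemiringAction H R]

open Classical in
/-- The element of the coinduction that is supported on `H` and takes the value `a` at `1`. -/
noncomputable def coindRing.single (a : R) : coindRing H R :=
  ⟨fun x => if hx : x ∈ H then (⟨x, hx⟩ : H) • a else 0, fun h x => by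
    by_cases hx : x ∈ H
    · have hhx : (h : G) * x ∈ H := H.mul_mem h.2 hx
      simp only [hx, hhx, dif_pos]
      rw [← mul_smul]
      rfl
    · have hhx : (h : G) * x ∉ H := fun h' => hx ((H.mul_mem_cancel_left h.2).1 h')
      simp only [hx, hhx, dif_neg, not_false_eq_true, smul_zero]⟩

theorem coindRing.single_of_mem (a : R) (h : H) : (coindRing.single H R a).1 h = h • a := by
  simp [coindRing.single]

theorem coindRing.single_of_notMem (a : R) {x : G} (hx : x ∉ H) :
    (coindRing.single H R a).1 x = 0 := by
  simp [coindRing.single, hx]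

theorem coindRing.single_eq_zero {a : R} (h : coindRing.single H R a = 0) : a = 0 := by
  have h1 := coindRing.single_of_mem H R a 1
  rw [h, one_smul] at h1
  exact h1.symm

variable {R}

theorem isDomainLikeRing_iff :
    IsDomainLikeRing H R ↔
      Nontrivial R ∧ ∀ x y : R, x ≠ 0 → y ≠ 0 → ∃ h : H, x * (h • y) ≠ 0 := by
  constructor
  · intro h
    refine ⟨?_, fun x y hx hy => ?_⟩
    · by_contra hn
      rw [not_nontrivial_iff_subsingleton] at hn
      exact h.ne_top (Subsingleton.elim _ _)
    · obtain ⟨g, hg⟩ := h.exists_mul_smul_notMem x y (by simpa using hx) (by simpa using hy)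
      exact ⟨g, by simpa using hg⟩
  · rintro ⟨_, h⟩
    refine ⟨fun g x hx => ?_, bot_ne_top, fun x y hx hy => ?_⟩
    · rw [Ideal.mem_bot] at hx ⊢
      rw [hx, smul_zero]
    · obtain ⟨g, hg⟩ := h x y (by simpa using hx) (by simpa using hy)
      exact ⟨g, by simpa using hg⟩

end CoindRing

theorem isDomainLikeRing_coindRing_iff {G : Type u} [Group G] (H : Subgroup G) (R : Type v)
    [CommRing R] [MulSemiringAction H R] :
    IsDomainLikeRing G (coindRing H R) ↔ IsDomainLikeRing H R := by
  constructor
  · intro h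
    refine (isDomainLikeRing_iff H).2 ⟨?_, fun a b ha hb => ?_⟩
    · by_contra hn
      rw [not_nontrivial_iff_subsingleton] at hn
      exact h.ne_top (Subsingleton.elim _ _)
    · obtain ⟨g, hg⟩ := h.exists_mul_smul_notMem (coindRing.single H R a) (coindRing.single H R b)
        (fun h0 => ha (coindRing.single_eq_zero H R h0))
        (fun h0 => hb (coindRing.single_eq_zero H R h0))
      by_contra! hab
      -- A value at `x` can be nonzero only if `x` and `x * g` lie in `H`, hence `g ∈ H`; it is then
      -- `x • (a * g • b)`.
      refine hg (Subtype.ext (funext fun x => ?_))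
      change (coindRing.single H R a).1 x * (coindRing.single H R b).1 (x * g) = 0
      by_cases hx : x ∈ H
      · by_cases hg' : g ∈ H
        · have h1 := coindRing.single_of_mem H R a ⟨x, hx⟩
          have h2 := coindRing.single_of_mem H R b (⟨x, hx⟩ * ⟨g, hg'⟩)
          change (coindRing.single H R a).1 x = _ at h1
          change (coindRing.single H R b).1 (x * g) = _ at h2
          rw [h1, h2, mul_smul, ← smul_mul', hab, smul_zero]
        · rw [coindRing.single_of_notMem H R b fun h' => hg' ((H.mul_mem_cancel_left hx).1 h'),
            mul_zero]
      · rw [coindRing.single_of_notMem H R a hx, zero_mul]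
  · intro h
    obtain ⟨_, h⟩ := (isDomainLikeRing_iff H).1 h
    refine ⟨fun g x hx => ?_, fun htop => ?_, fun φ ψ hφ hψ => ?_⟩
    · rw [Ideal.mem_bot] at hx ⊢
      rw [hx, smul_zero]
    · have h1 : (1 : coindRing H R) ∈ (⊥ : Ideal (coindRing H R)) := htop ▸ Submodule.mem_top
      have h2 : (1 : coindRing H R).1 1 = (0 : coindRing H R).1 1 :=
        congrArg (fun φ : coindRing H R => φ.1 1) h1
      exact one_ne_zero (α := R) h2
    · have key : ∀ φ : coindRing H R, φ ∉ (⊥ : Ideal (coindRing H R)) → ∃ x, φ.1 x ≠ 0 := by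
        intro φ hφ
        by_contra! h0
        exact hφ (Subtype.ext (funext h0))
      obtain ⟨x, hx⟩ := key φ hφ
      obtain ⟨y, hy⟩ := key ψ hψ
      obtain ⟨k, hk⟩ := h _ _ hx hy
      -- Translation by this element brings `ψ (k * y) = k • ψ y` to the point `x`.
      refine ⟨x⁻¹ * (k * y), fun h0 => hk ?_⟩
      have h1 : φ.1 x * ψ.1 (x * (x⁻¹ * (k * y))) = 0 :=
        congrArg (fun φ : coindRing H R => φ.1 x) h0
      rwa [mul_inv_cancel_left, ψ.2] at h1

/-! ### Constructions of finite `G`-sets -/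

namespace FinGSet

variable {G : Type u} [Group G]

/-- The empty `G`-set maps to every `G`-set. -/
def emptyHom (X : FinGSet G) : FinGSet.empty G →[G] X :=
  ⟨fun x => x.elim, fun _ x => x.elim⟩

instance : IsEmpty (FinGSet.empty G) := inferInstanceAs (IsEmpty PEmpty)

/-- The complement of the image of a map of `G`-sets. -/
def compl {X Y : FinGSet G} (f : X →[G] Y) : FinGSet G where
  carrier := {y : Y // y ∉ Set.range f}
  action :=
    { smul := fun g y => ⟨g • y.1, by
        rintro ⟨x, hx⟩
        exact y.2 ⟨g⁻¹ • x, by rw [map_smul, hx, inv_smul_smul]⟩⟩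
      one_smul := fun y => Subtype.ext (one_smul G y.1)
      mul_smul := fun g k y => Subtype.ext (mul_smul g k y.1) }

/-- The inclusion of the complement of the image of a map of `G`-sets. -/
def complHom {X Y : FinGSet G} (f : X →[G] Y) : compl f →[G] Y :=
  ⟨fun y => y.1, fun _ _ => rfl⟩

theorem complHom_injective {X Y : FinGSet G} (f : X →[G] Y) :
    Function.Injective (complHom f) := fun _ _ h => Subtype.ext h

theorem ne_complHom {X Y : FinGSet G} (f : X →[G] Y) (x : X) (y : compl f) :
    f x ≠ complHom f y := fun h => y.2 ⟨x, h⟩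

theorem bijective_sumElim_complHom {X Y : FinGSet G} (f : X →[G] Y)
    (hf : Function.Injective f) : Function.Bijective (Sum.elim f (complHom f)) := by
  refine ⟨hf.sumElim (complHom_injective f) (ne_complHom f), fun y => ?_⟩
  by_cases hy : y ∈ Set.range f
  · obtain ⟨x, hx⟩ := hy
    exact ⟨Sum.inl x, hx⟩
  · exact ⟨Sum.inr ⟨y, hy⟩, rfl⟩

/-- The fibre product of finite `G`-sets. -/
def fiberProduct {X Y Z : FinGSet G} (f : X →[G] Z) (g : Y →[G] Z) : FinGSet G where
  carrier := {p : X × Y // f p.1 = g p.2}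
  action :=
    { smul := fun k p => ⟨(k • p.1.1, k • p.1.2), by rw [map_smul, map_smul, p.2]⟩
      one_smul := fun p => Subtype.ext (one_smul G p.1)
      mul_smul := fun k l p => Subtype.ext (mul_smul k l p.1) }

/-- The first projection of a fibre product. -/
def fiberProductFst {X Y Z : FinGSet G} (f : X →[G] Z) (g : Y →[G] Z) :
    fiberProduct f g →[G] X := ⟨fun p => p.1.1, fun _ _ => rfl⟩

/-- The second projection of a fibre product. -/
def fiberProductSnd {X Y Z : FinGSet G} (f : X →[G] Z) (g : Y →[G] Z) :
    fiberProduct f g →[G] Y := ⟨fun p => p.1.2, fun _ _ => rfl⟩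

theorem isPullbackSquare_fiberProduct {X Y Z : FinGSet G} (f : X →[G] Z) (g : Y →[G] Z) :
    IsPullbackSquare (fiberProductFst f g) (fiberProductSnd f g) f g :=
  ⟨fun t => t.2, fun x y h => ⟨⟨(x, y), h⟩, ⟨rfl, rfl⟩,
    fun _ ht => Subtype.ext (Prod.ext ht.1 ht.2)⟩⟩

variable [Finite G]

/-- The base point of the `G`-set `G ⧸ K`. -/
def orbitPt (K : Subgroup G) : orbit K := (QuotientGroup.mk 1 : G ⧸ K)

theorem exists_smul_orbitPt {K : Subgroup G} (x : orbit K) : ∃ g : G, g • orbitPt K = x :=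
  MulAction.exists_smul_eq G (show G ⧸ K from orbitPt K) (show G ⧸ K from x)

theorem smul_orbitPt_eq_iff {K : Subgroup G} {g k : G} :
    g • orbitPt K = k • orbitPt K ↔ g⁻¹ * k ∈ K := by
  have h : ∀ g : G, g • orbitPt K = (QuotientGroup.mk g : G ⧸ K) := fun g =>
    congrArg (QuotientGroup.mk (s := K)) (mul_one g)
  rw [h, h]
  exact QuotientGroup.eq

theorem smul_orbitPt_of_mem {K : Subgroup G} {g : G} (hg : g ∈ K) :
    g • orbitPt K = orbitPt K := by
  have := (smul_orbitPt_eq_iff (K := K) (g := 1) (k := g)).2 (by simpa using hg)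
  rw [one_smul] at this
  exact this.symm

theorem orbitHom_ext {K : Subgroup G} {X : FinGSet G} {f f' : orbit K →[G] X}
    (h : f (orbitPt K) = f' (orbitPt K)) : f = f' := by
  ext x
  obtain ⟨g, rfl⟩ := exists_smul_orbitPt x
  rw [map_smul, map_smul, h]

/-- The map `G ⧸ K → X` that sends the base point to a given `K`-fixed point. -/
def orbitLift (K : Subgroup G) (X : FinGSet G) (x : X) (hx : ∀ g ∈ K, g • x = x) :
    orbit K →[G] X where
  toFun y := Quotient.liftOn' (s₁ := QuotientGroup.leftRel K) y (fun g => g • x) fun a b hab => by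
    have h := hx _ (QuotientGroup.leftRel_apply.1 hab)
    rw [mul_smul, inv_smul_eq_iff] at h
    exact h.symm
  map_smul' g y := by
    induction y using Quotient.inductionOn' with
    | h k => exact mul_smul g k x

@[simp]
theorem orbitLift_orbitPt (K : Subgroup G) (X : FinGSet G) (x : X) (hx : ∀ g ∈ K, g • x = x) :
    orbitLift K X x hx (orbitPt K) = x := one_smul G x

theorem exists_injective_orbitHom {X : FinGSet G} (x : X) :
    ∃ (K : Subgroup G) (t : orbit K →[G] X), Function.Injective t := by
  refine ⟨MulAction.stabilizer G x, orbitLift _ X x fun _ hg =>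
    MulAction.mem_stabilizer_iff.1 hg, fun y z h => ?_⟩
  obtain ⟨g, rfl⟩ := exists_smul_orbitPt y
  obtain ⟨k, rfl⟩ := exists_smul_orbitPt z
  rw [map_smul, map_smul, orbitLift_orbitPt] at h
  rw [smul_orbitPt_eq_iff, MulAction.mem_stabilizer_iff, mul_smul, ← h, inv_smul_smul]

/-! ### Induction of transitive sets from `H` to `G` -/

section Induction

variable {H : Subgroup G}

/-- For `L ≤ H`, the `H`-orbit of the base point of `G ⧸ L` is `H ⧸ L`. -/
def unitHom (L : Subgroup H) :
    orbit L →[H] (orbit (L.map H.subtype)).restrict H :=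
  orbitLift L _ (orbitPt (L.map H.subtype)) fun _ hg =>
    smul_orbitPt_of_mem (G := G) (Subgroup.mem_map_of_mem H.subtype hg)

theorem unitHom_smul_orbitPt (L : Subgroup H) (h : H) :
    unitHom L (h • orbitPt L) = (h : G) • orbitPt (L.map H.subtype) := by
  rw [map_smul]
  exact congrArg (fun x : orbit (L.map H.subtype) => (h : G) • x) (orbitLift_orbitPt L _ _ _)

theorem unitHom_orbitPt (L : Subgroup H) :
    unitHom L (orbitPt L) = orbitPt (L.map H.subtype) := orbitLift_orbitPt L _ _ _

theorem unitHom_injective (L : Subgroup H) : Function.Injective (unitHom L) := by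
  intro y z h
  obtain ⟨g, rfl⟩ := exists_smul_orbitPt y
  obtain ⟨k, rfl⟩ := exists_smul_orbitPt z
  rw [unitHom_smul_orbitPt, unitHom_smul_orbitPt] at h
  obtain ⟨l, hl, hlk⟩ := smul_orbitPt_eq_iff.1 h
  rw [smul_orbitPt_eq_iff]
  have : g⁻¹ * k = l := Subtype.ext hlk.symm
  rwa [this]

/-- Since `L ≤ H`, there is a projection `G ⧸ L → G ⧸ H`, and the image of `unitHom L` is the fibre
over the trivial coset, whose stabilizer is `H`. -/
theorem mem_of_smul_unitHom_eq {L : Subgroup H} {y z : orbit L} {g : G}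
    (h : g • (show orbit (L.map H.subtype) from unitHom L y) = unitHom L z) : g ∈ H := by
  obtain ⟨k, rfl⟩ := exists_smul_orbitPt y
  obtain ⟨l, rfl⟩ := exists_smul_orbitPt z
  rw [unitHom_smul_orbitPt, unitHom_smul_orbitPt, ← mul_smul] at h
  obtain ⟨m, -, hm⟩ := smul_orbitPt_eq_iff.1 h
  have : g = l * (m : G)⁻¹ * (k : G)⁻¹ := by
    change (m : G) = _ at hm
    rw [hm]
    group
  rw [this]
  exact H.mul_mem (H.mul_mem l.2 (H.inv_mem m.2)) (H.inv_mem k.2)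

/-- The map `G ⧸ L → X` adjoint to a map `H ⧸ L → Res X`. -/
def adjointHom {L : Subgroup H} {X : FinGSet G} (t : orbit L →[H] X.restrict H) :
    orbit (L.map H.subtype) →[G] X :=
  orbitLift _ X (t (orbitPt L)) (by
    rintro _ ⟨l, hl, rfl⟩
    exact (t.map_smul l (orbitPt L)).symm.trans (congrArg t (smul_orbitPt_of_mem hl)))

theorem adjointHom_comp_unitHom {L : Subgroup H} {X : FinGSet G}
    (t : orbit L →[H] X.restrict H) :
    (restrictHom H (adjointHom t)).comp (unitHom L) = t := by
  refine orbitHom_ext ?_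
  change adjointHom t (unitHom L (orbitPt L)) = _
  rw [unitHom_orbitPt]
  exact orbitLift_orbitPt _ X _ _

/-- The map `G ⧸ K → G ⧸ L` induced from a map `H ⧸ K → H ⧸ L`. -/
def inducedHom {K L : Subgroup H} (f : orbit K →[H] orbit L) :
    orbit (K.map H.subtype) →[G] orbit (L.map H.subtype) :=
  adjointHom ((unitHom L).comp f)

theorem inducedHom_comp_unitHom {K L : Subgroup H} (f : orbit K →[H] orbit L) :
    (restrictHom H (inducedHom f)).comp (unitHom K) = (unitHom L).comp f :=
  adjointHom_comp_unitHom _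

theorem inducedHom_unitHom {K L : Subgroup H} (f : orbit K →[H] orbit L) (x : orbit K) :
    inducedHom f (unitHom K x) = unitHom L (f x) :=
  DFunLike.congr_fun (inducedHom_comp_unitHom f) x

/-- The induced map lies over `G ⧸ H`, so the preimage of the fibre over the trivial coset is again
that fibre. Base change along this square makes restriction along `unitHom` commute with transfers
and norms. -/
theorem isPullbackSquare_inducedHom {K L : Subgroup H} (f : orbit K →[H] orbit L) :
    IsPullbackSquare (unitHom K) f (restrictHom H (inducedHom f)) (unitHom L) := by
  refine ⟨inducedHom_unitHom f, fun x y hxy => ?_⟩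
  obtain ⟨g, hg⟩ := exists_smul_orbitPt (G := G) (K := K.map H.subtype) x
  have hx : g • (show orbit (K.map H.subtype) from unitHom K (orbitPt K)) = x := by
    rw [unitHom_orbitPt]
    exact hg
  have hgH : g ∈ H := by
    refine mem_of_smul_unitHom_eq (y := f (orbitPt K)) (z := y) ?_
    rw [← hxy, ← hx, ← inducedHom_unitHom]
    exact ((inducedHom f).map_smul g _).symm
  have ht : unitHom K ((⟨g, hgH⟩ : H) • orbitPt K) = x := (map_smul _ _ _).trans hx
  refine ⟨(⟨g, hgH⟩ : H) • orbitPt K, ⟨ht, unitHom_injective L ?_⟩,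
    fun t h => unitHom_injective K (h.1.trans ht.symm)⟩
  rw [← inducedHom_unitHom, ht]
  exact hxy

end Induction

end FinGSet

/-! ### Transfers and norms along disjoint unions -/

namespace TambaraFunctor

open FinGSet

variable {G : Type u} [Group G] (R : TambaraFunctor.{u, w} G)

theorem isPullbackSquare_of_injective {X Y : FinGSet G} (f : X →[G] Y)
    (hf : Function.Injective f) :
    IsPullbackSquare (MulActionHom.id G (X := X)) (MulActionHom.id G (X := X)) f f :=
  ⟨fun _ => rfl, fun x _ h => ⟨x, ⟨rfl, hf h⟩, fun _ ht => ht.1⟩⟩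

theorem isPullbackSquare_of_disjoint {X Y Z : FinGSet G} (f : X →[G] Z) (g : Y →[G] Z)
    (h : ∀ x y, f x ≠ g y) : IsPullbackSquare (emptyHom X) (emptyHom Y) f g :=
  ⟨fun t => isEmptyElim t, fun x y hxy => (h x y hxy).elim⟩

theorem res_tr_self {X Y : FinGSet G} (f : X →[G] Y) (hf : Function.Injective f) (a : R.obj X) :
    R.res f (R.tr f a) = a := by
  rw [R.res_tr _ _ f f (isPullbackSquare_of_injective f hf), R.res_id, R.tr_id]

theorem res_nm_self {X Y : FinGSet G} (f : X →[G] Y) (hf : Function.Injective f) (a : R.obj X) :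
    R.res f (R.nm f a) = a := by
  rw [R.res_nm _ _ f f (isPullbackSquare_of_injective f hf), R.res_id, R.nm_id]

theorem res_tr_of_disjoint {X Y Z : FinGSet G} (f : X →[G] Z) (g : Y →[G] Z)
    (h : ∀ x y, f x ≠ g y) (a : R.obj X) : R.res g (R.tr f a) = 0 := by
  have := R.subsingleton_of_isEmpty (FinGSet.empty G) inferInstance
  rw [R.res_tr _ _ f g (isPullbackSquare_of_disjoint f g h), Subsingleton.elim (R.res _ a) 0,
    map_zero]

/-- The pullback is empty, and every element of the zero ring equals `1`; a norm over empty fibres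
is thus an empty product, where a transfer is an empty sum. -/
theorem res_nm_of_disjoint {X Y Z : FinGSet G} (f : X →[G] Z) (g : Y →[G] Z)
    (h : ∀ x y, f x ≠ g y) (a : R.obj X) : R.res g (R.nm f a) = 1 := by
  have := R.subsingleton_of_isEmpty (FinGSet.empty G) inferInstance
  rw [R.res_nm _ _ f g (isPullbackSquare_of_disjoint f g h), Subsingleton.elim (R.res _ a) 1,
    map_one]

/-- Under `R Y ≅ R X × R (compl f)`, transfer along a summand is extension by `0`. -/
theorem eq_tr_add_tr {X Y : FinGSet G} (f : X →[G] Y) (hf : Function.Injective f) (c : R.obj Y) :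
    c = R.tr f (R.res f c) + R.tr (complHom f) (R.res (complHom f) c) := by
  refine (R.bijective_of_coproduct _ _ (bijective_sumElim_complHom f hf)).1 (Prod.ext ?_ ?_)
  · change R.res f c = R.res f _
    rw [map_add, R.res_tr_self f hf,
      R.res_tr_of_disjoint _ f fun x y => (ne_complHom f y x).symm, add_zero]
  · change R.res (complHom f) c = R.res (complHom f) _
    rw [map_add, R.res_tr_self _ (complHom_injective f),
      R.res_tr_of_disjoint f _ (ne_complHom f), zero_add]

/-- The multiplicative analogue: norm along a summand is extension by `1`. -/
theorem eq_nm_mul_nm {X Y : FinGSet G} (f : X →[G] Y) (hf : Function.Injective f) (c : R.obj Y) :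
    c = R.nm f (R.res f c) * R.nm (complHom f) (R.res (complHom f) c) := by
  refine (R.bijective_of_coproduct _ _ (bijective_sumElim_complHom f hf)).1 (Prod.ext ?_ ?_)
  · change R.res f c = R.res f _
    rw [map_mul, R.res_nm_self f hf,
      R.res_nm_of_disjoint _ f fun x y => (ne_complHom f y x).symm, mul_one]
  · change R.res (complHom f) c = R.res (complHom f) _
    rw [map_mul, R.res_nm_self _ (complHom_injective f),
      R.res_nm_of_disjoint f _ (ne_complHom f), one_mul]

variable [Finite G]

/-- An additive submonoid of `R X` contains `c` as soon as it contains the transfers of all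
restrictions of `c` to orbits. -/
theorem mem_of_tr_res_mem {X : FinGSet G} (A : AddSubmonoid (R.obj X)) (c : R.obj X)
    (h : ∀ (K : Subgroup G) (t : orbit K →[G] X), R.tr t (R.res t c) ∈ A) : c ∈ A := by
  induction hn : Nat.card X using Nat.strong_induction_on generalizing X with
  | _ n ih =>
    by_cases hX : IsEmpty X
    · have := R.subsingleton_of_isEmpty X hX
      rw [Subsingleton.elim c 0]
      exact A.zero_mem
    · obtain ⟨x⟩ := not_isEmpty_iff.1 hX
      obtain ⟨K, t, ht⟩ := exists_injective_orbitHom x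
      rw [R.eq_tr_add_tr t ht c]
      refine A.add_mem (h K t) ?_
      -- One orbit is split off; on the smaller complement, `A` is replaced by its preimage under
      -- transfer.
      refine ih (Nat.card (compl t)) ?_ (A.comap (R.tr (complHom t))) _ (fun L s => ?_) rfl
      · rw [← hn]
        have h1 : Nat.card (compl t) = Set.ncard (Set.range t)ᶜ := rfl
        rw [h1, Set.ncard_compl]
        have h2 : 0 < (Set.range t).ncard := by
          rw [Set.ncard_pos]
          exact ⟨_, orbitPt K, rfl⟩
        have h3 : 0 < Nat.card X := by
          have : Nonempty X := ⟨x⟩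
          exact Nat.card_pos
        omega
      · rw [AddSubmonoid.mem_comap, ← R.res_comp, ← R.tr_comp]
        exact h L _

theorem eq_zero_of_res_eq_zero {X : FinGSet G} (c : R.obj X)
    (h : ∀ (K : Subgroup G) (t : orbit K →[G] X), R.res t c = 0) : c = 0 := by
  have := R.mem_of_tr_res_mem ⊥ c fun K t => by
    rw [h K t, map_zero]
    exact AddSubmonoid.zero_mem _
  simpa using this

end TambaraFunctor

/-! ### Tambara ideals on all finite `G`-sets -/

namespace TambaraIdeal

open FinGSet

section Extend

variable {G : Type u} [Group G] [Finite G] {R : TambaraFunctor.{u, w} G} (I : TambaraIdeal R)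

/-- The value of a Tambara ideal on an arbitrary finite `G`-set. -/
def extend (X : FinGSet G) : Ideal (R.obj X) :=
  ⨅ (K : Subgroup G) (t : orbit K →[G] X), (I.carrier K).comap (R.res t)

variable {I}

theorem mem_extend {X : FinGSet G} {a : R.obj X} :
    a ∈ I.extend X ↔ ∀ (K : Subgroup G) (t : orbit K →[G] X), R.res t a ∈ I.carrier K := by
  simp [extend, Ideal.mem_comap]

theorem res_mem_extend {X Y : FinGSet G} (f : X →[G] Y) {a : R.obj Y} (ha : a ∈ I.extend Y) :
    R.res f a ∈ I.extend X := by
  rw [mem_extend] at ha ⊢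
  intro K t
  rw [← R.res_comp]
  exact ha K _

theorem mem_extend_orbit {K : Subgroup G} {a : R.obj (orbit K)} :
    a ∈ I.extend (orbit K) ↔ a ∈ I.carrier K := by
  rw [mem_extend]
  refine ⟨fun h => ?_, fun h L t => I.res_mem t a h⟩
  have := h K (MulActionHom.id G)
  rwa [R.res_id] at this

/-- Base change reduces to a target orbit. The transfer is then a sum over the orbits of the fibre
product, and each term is a transfer between orbits. -/
theorem tr_mem_extend {X Y : FinGSet G} (f : X →[G] Y) {a : R.obj X} (ha : a ∈ I.extend X) :
    R.tr f a ∈ I.extend Y := by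
  rw [mem_extend]
  intro K t
  rw [R.res_tr _ _ f t (isPullbackSquare_fiberProduct f t)]
  refine R.mem_of_tr_res_mem
    ((I.carrier K).toAddSubmonoid.comap (R.tr (fiberProductSnd f t))) _ fun L s => ?_
  change R.tr (fiberProductSnd f t) _ ∈ I.carrier K
  rw [← R.tr_comp]
  exact I.tr_mem _ _ (mem_extend.1 (res_mem_extend _ ha) L s)

/-- After base change to an orbit, the norm is a product over the orbits of the fibre product, so a
single factor in the ideal suffices. Surjectivity supplies that factor; an empty product would be
`1`. -/
theorem nm_mem_extend {X Y : FinGSet G} (f : X →[G] Y) (hf : Function.Surjective f)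
    {a : R.obj X} (ha : a ∈ I.extend X) : R.nm f a ∈ I.extend Y := by
  rw [mem_extend]
  intro K t
  rw [R.res_nm _ _ f t (isPullbackSquare_fiberProduct f t)]
  obtain ⟨x, hx⟩ := hf (t (orbitPt K))
  obtain ⟨L, s, hs⟩ := exists_injective_orbitHom (X := fiberProduct f t) ⟨(x, orbitPt K), hx⟩
  rw [R.eq_nm_mul_nm s hs (R.res (fiberProductFst f t) a), map_mul, ← R.nm_comp]
  exact Ideal.mul_mem_right _ _ (I.nm_mem _ _ (mem_extend.1 (res_mem_extend _ ha) L s))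

/-- The zero family is itself a Tambara ideal, so it contains the span of the products as soon as it
contains the products. -/
theorem mul_le_bot_iff {J : TambaraIdeal R} :
    I * J ≤ ⊥ ↔ ∀ K, ∀ a ∈ I.carrier K, ∀ b ∈ J.carrier K, a * b = 0 := by
  constructor
  · intro h K a ha b hb
    refine h K ?_
    change _ ∈ ⨅ Q : {Q : TambaraIdeal R // _}, Q.1.carrier K
    rw [Ideal.mem_iInf]
    exact fun Q => Q.2 K ⟨a, ha, b, hb, rfl⟩
  · intro h K c hc
    change c ∈ ⨅ Q : {Q : TambaraIdeal R // _}, Q.1.carrier K at hc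
    rw [Ideal.mem_iInf] at hc
    refine hc ⟨⊥, ?_⟩
    rintro L _ ⟨a, ha, b, hb, rfl⟩
    exact h L a ha b hb

theorem bot_eq_top_iff :
    (⊥ : TambaraIdeal R) = ⊤ ↔ ∀ K : Subgroup G, (1 : R.obj (orbit K)) = 0 := by
  constructor
  · intro h K
    have h1 : (1 : R.obj (orbit K)) ∈ (⊤ : TambaraIdeal R).carrier K := Submodule.mem_top
    rw [← h] at h1
    exact h1
  · intro h
    refine TambaraIdeal.ext (funext fun K => ?_)
    exact ((Ideal.eq_top_iff_one _).2 (h K) : (⊥ : Ideal (R.obj (orbit K))) = ⊤)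

end Extend

/-! ### Tambara ideals under coinduction and restriction -/

section Coind

variable {G : Type u} [Group G] [Finite G] {H : Subgroup G} {R : TambaraFunctor.{u, w} H}

/-- The coinduction of a Tambara ideal. -/
def coind (I : TambaraIdeal R) : TambaraIdeal (TambaraFunctor.coind H R) where
  carrier K := I.extend ((orbit K).restrict H)
  tr_mem f _ ha := tr_mem_extend (restrictHom H f) ha
  nm_mem f _ ha := nm_mem_extend (restrictHom H f) (surjective_orbitHom f) ha
  res_mem f _ ha := res_mem_extend (restrictHom H f) ha

theorem res_unitHom_surjective (L : Subgroup H) : Function.Surjective (R.res (unitHom L)) :=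
  fun a => ⟨_, R.res_tr_self _ (unitHom_injective L) a⟩

/-- The restriction to `R` of a Tambara ideal of the coinduction of `R`. -/
def restrict (J : TambaraIdeal (TambaraFunctor.coind H R)) : TambaraIdeal R where
  -- By surjectivity of `R.res (unitHom L)`, every element of this ideal is the restriction of an
  -- element of `J`.
  carrier L := (show Ideal (R.obj ((orbit (L.map H.subtype)).restrict H)) from
    J.carrier (L.map H.subtype)).map (R.res (unitHom L))
  tr_mem {K L} f a ha := by
    obtain ⟨b, hb, rfl⟩ := (Ideal.mem_map_iff_of_surjective _ (res_unitHom_surjective K)).1 ha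
    rw [← R.res_tr _ _ _ _ (isPullbackSquare_inducedHom f)]
    exact Ideal.mem_map_of_mem _ (J.tr_mem (inducedHom f) b hb)
  nm_mem {K L} f a ha := by
    obtain ⟨b, hb, rfl⟩ := (Ideal.mem_map_iff_of_surjective _ (res_unitHom_surjective K)).1 ha
    rw [← R.res_nm _ _ _ _ (isPullbackSquare_inducedHom f)]
    exact Ideal.mem_map_of_mem _ (J.nm_mem (inducedHom f) b hb)
  res_mem {K L} f a ha := by
    obtain ⟨b, hb, rfl⟩ := (Ideal.mem_map_iff_of_surjective _ (res_unitHom_surjective L)).1 ha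
    rw [← R.res_comp, ← inducedHom_comp_unitHom, R.res_comp]
    exact Ideal.mem_map_of_mem _ (J.res_mem (inducedHom f) b hb)

theorem coind_mul_coind_le_bot {I J : TambaraIdeal R} (h : I * J ≤ ⊥) :
    I.coind * J.coind ≤ ⊥ := by
  rw [mul_le_bot_iff] at h ⊢
  intro K a ha b hb
  refine R.eq_zero_of_res_eq_zero (X := (orbit K).restrict H) _ fun L t => ?_
  exact (map_mul (R.res t) _ _).trans (h L _ (mem_extend.1 ha L t) _ (mem_extend.1 hb L t))

/-- Extending `a` by zero from `H ⧸ L` to `Res (G ⧸ L)` gives an element of `I.coind` that restricts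
back to `a`. -/
theorem le_bot_of_coind_le_bot {I : TambaraIdeal R} (h : I.coind ≤ ⊥) : I ≤ ⊥ := by
  intro L a ha
  have h0 : R.tr (unitHom L) a = 0 := h _ (tr_mem_extend (unitHom L) (mem_extend_orbit.2 ha))
  have h1 := R.res_tr_self _ (unitHom_injective L) a
  rw [h0, map_zero] at h1
  exact h1.symm

theorem restrict_mul_restrict_le_bot {I J : TambaraIdeal (TambaraFunctor.coind H R)}
    (h : I * J ≤ ⊥) : I.restrict * J.restrict ≤ ⊥ := by
  rw [mul_le_bot_iff] at h ⊢
  intro L a ha b hb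
  obtain ⟨a', ha', rfl⟩ := (Ideal.mem_map_iff_of_surjective _ (res_unitHom_surjective L)).1 ha
  obtain ⟨b', hb', rfl⟩ := (Ideal.mem_map_iff_of_surjective _ (res_unitHom_surjective L)).1 hb
  rw [← map_mul]
  exact (congrArg _ (h _ a' ha' b' hb')).trans (map_zero _)

/-- Zero is detected on orbits. By adjunction each `t : H ⧸ L → Res (G ⧸ K)` factors through
`unitHom L` followed by a `G`-map, so `R.res t a` lies in `J.restrict`. -/
theorem le_bot_of_restrict_le_bot {J : TambaraIdeal (TambaraFunctor.coind H R)}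
    (h : J.restrict ≤ ⊥) : J ≤ ⊥ := by
  intro K a ha
  refine R.eq_zero_of_res_eq_zero (X := (orbit K).restrict H) a fun L t => ?_
  rw [← adjointHom_comp_unitHom t]
  refine (R.res_comp _ _ _).trans ?_
  exact h L (Ideal.mem_map_of_mem _ (J.res_mem (adjointHom t) a ha))

theorem bot_eq_top_coind_iff :
    (⊥ : TambaraIdeal (TambaraFunctor.coind H R)) = ⊤ ↔ (⊥ : TambaraIdeal R) = ⊤ := by
  rw [bot_eq_top_iff, bot_eq_top_iff]
  constructor
  · intro h L
    have h1 : (1 : R.obj ((orbit (L.map H.subtype)).restrict H)) = 0 := h _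
    rw [← map_one (R.res (unitHom L)), h1, map_zero]
  · intro h K
    refine R.eq_zero_of_res_eq_zero (X := (orbit K).restrict H) 1 fun L t => ?_
    rw [map_one, h]

end Coind

end TambaraIdeal

theorem TambaraFunctor.isDomainLike_coind_iff {G : Type u} [Group G] [Finite G]
    {H : Subgroup G} (R : TambaraFunctor.{u, w} H) :
    (TambaraFunctor.coind H R).IsDomainLike ↔ R.IsDomainLike := by
  constructor
  · intro h
    refine ⟨fun h' => h.ne_top (TambaraIdeal.bot_eq_top_coind_iff.2 h'), fun I J hIJ => ?_⟩
    exact (h.le_or_le _ _ (TambaraIdeal.coind_mul_coind_le_bot hIJ)).imp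
      TambaraIdeal.le_bot_of_coind_le_bot TambaraIdeal.le_bot_of_coind_le_bot
  · intro h
    refine ⟨fun h' => h.ne_top (TambaraIdeal.bot_eq_top_coind_iff.1 h'), fun I J hIJ => ?_⟩
    exact (h.le_or_le _ _ (TambaraIdeal.restrict_mul_restrict_le_bot hIJ)).imp
      TambaraIdeal.le_bot_of_restrict_le_bot TambaraIdeal.le_bot_of_restrict_le_bot

theorem mainTheorem12 {G : Type u} [Group G] [Finite G] (H : Subgroup G) :
    (∀ (R : Type v) [CommRing R] [MulSemiringAction H R],
      IsDomainLikeRing G (coindRing H R) ↔ IsDomainLikeRing H R) ∧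
    (∀ R : TambaraFunctor.{u, w} H,
      (TambaraFunctor.coind H R).IsDomainLike ↔ R.IsDomainLike) :=
  ⟨fun R _ _ => isDomainLikeRing_coindRing_iff H R, fun R => R.isDomainLike_coind_iff⟩
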